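/- Let $K$ be a finite simplicial complex (a finite collection of non-empty finite sets, closed under non-empty subsets) on totally ordered vertices, and let $\mathbb F$ be a field. Let $f\colon K\to\mathbb R$ be a generalized discrete Morse function: $f$ is monotonic with respect to inclusion, and there is a partition $\hat V$ of $K$ into intervals $[\rho,\phi]=\{\psi\in K\mid\rho\subseteq\psi\subseteq\phi\}$ such that for $\sigma\subseteq\tau$ in $K$ one has $f(\sigma)=f(\tau)$ if and only if $\sigma$ and $\tau$ lie in a common interval of $\hat V$. A simplex $\sigma$ is critical if $\{\sigma\}\in\hat V$. On $\hat V$ let $\le$ be the transitive closure of the relation "$I\sim J$ if some $\sigma\in I$ is a face of some $\tau\in J$". The descending complex $D_r(f)$ at scale $r\in\mathbb R$ is the union of all intervals $I\in\hat V$ with $I\le\{\sigma\}$ for some critical simplex $\sigma$ with $f(\sigma)\le r$. The $f$-lexicographic order $\le_f$ orders the simplices of $K$ by their value under $f$, then by dimension, then lexicographically by their vertices (listed either always in increasing order or always in decreasing order; the result holds for both conventions). Let $D$ be the boundary matrix of the simplicial chain complex $C_*(K;\mathbb F)$ (simplices oriented by the vertex order) with rows and columns ordered by $\le_f$. The pivot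 of a non-zero column is its largest index with a non-zero entry (the zero column has a pivot smaller than every index); a column $R_j$ is reduced if its pivot cannot be decreased by adding a linear combination of the columns $R_i$ with $i<j$. A reduction of $D$ is a product $R=D\cdot S$ all of whose columns are reduced, where $S$ is upper triangular, of full rank, and respects the degrees. It is totally reduced if $R_{s,j}=0$ whenever $i<j$ and $s$ is the pivot of $R_i\ne 0$. A pair $(\sigma,\tau)$ is a persistence pair if $\sigma$ is the pivot of the column of $\tau$ in some reduction of $D$ (this does not depend on the reduction); it is non-zero if $f(\sigma)\ne f(\tau)$. For chains $c,d$ of the same degree, write $c\sqsubseteq d$ if the supports of $c$ and $d$ are equal or the $\le_f$-largest simplex of their symmetric difference lies in the support of $d$, and $c\sqsubset d$ if $c\sqsubseteq d$ but not $d\sqsubseteq c$. A cycle $z$ of a subcomplex $L$ is lexicographically minimal in $L$ if there is no chain $e$ of $L$ with $z+\partial e\sqsubset z$. Let $R=D\cdot S$ be a totally reduced reduction of $D$, let $(\sigma,\tau)$ be a non-zero persistence pair, and put $r=f(\sigma)$, $s=f(\tau)$. Then the following hold. 1. $S_{\tau,\tau}^{-1}R_\tau$ (which is $R_\tau$ itself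 if $S$ has unit diagonal) is the unique lexicographically minimal cycle of the homology class $[\partial\tau]$ in the subcomplex $\{\eta\in K\mid\eta<_f\tau\}$. 2. If no critical simplex $\eta<_f\tau$ satisfies both $f(\eta)=s$ and $\dim\eta=\dim\tau$, then $S_{\tau,\tau}^{-1}R_\tau$ is also the unique lexicographically minimal cycle of the homology class $[\partial\tau]$ in the open sublevel set $\{\eta\in K\mid f(\eta)<s\}$. 3. The cycle $R_\tau$ is supported on the descending complex $D_r(f)$: every simplex with non-zero coefficient in $R_\tau$ lies in $D_r(f)$. -/

import Mathlib

open scoped Matrix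

namespace WrapPersistence

section ElementwiseFiltration

/-! ### Based chain complexes with an elementwise filtration

The finite linear order `ι` is the ordered basis, `deg` records in which degree a basis element lives,
`D` is the filtration boundary matrix, and chains are coordinate vectors `ι → 𝔽`. -/

variable {ι 𝔽 : Type*} [LinearOrder ι] [Fintype ι] [Field 𝔽]

/-- The support of a chain: the basis elements with non-zero coefficient. -/
noncomputable def chainSupport (c : ι → 𝔽) : Finset ι :=
  open scoped Classical in Finset.univ.filter fun i => c i ≠ 0

/-- The pivot of a column: the largest index of a non-zero entry, and `⊥` for the zero column. -/
noncomputable def pivot (c : ι → 𝔽) : WithBot ι := (chainSupport c).max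

/-- Column `j` is reduced: its pivot cannot be decreased by adding a linear combination
`R *ᵥ a = ∑ i, a i • R_i` of the columns `R_i` with `i < j`. -/
def IsReducedColumn (R : Matrix ι ι 𝔽) (j : ι) : Prop :=
  ∀ a : ι → 𝔽, (∀ i, a i ≠ 0 → i < j) → pivot (R.col j) ≤ pivot (R.col j + R *ᵥ a)

/-- `R` is totally reduced: if `i < j` and the column `R_i` has pivot `s`, then `R s j = 0`. -/
def IsTotallyReduced (R : Matrix ι ι 𝔽) : Prop :=
  ∀ i j s : ι, i < j → pivot (R.col i) = s → R s j = 0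

/-- `S` is a reduction matrix for `D`: it has full rank, is upper triangular, respects the degrees,
and all columns of `D * S` are reduced. -/
structure IsReductionMatrix (deg : ι → ℕ) (D S : Matrix ι ι 𝔽) : Prop where
  fullRank : S.rank = Fintype.card ι
  upperTriangular : ∀ i j, S i j ≠ 0 → i ≤ j
  homogeneous : ∀ i j, S i j ≠ 0 → deg i = deg j
  reduced : ∀ j, IsReducedColumn (D * S) j

/-- `(i, j)` is a persistence pair: for some reduction `R = D * S`, the column `R_j` is non-zero
with pivot `i`. (This does not depend on the reduction.) -/
def IsPersistencePair (deg : ι → ℕ) (D : Matrix ι ι 𝔽) (i j : ι) : Prop :=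
  ∃ S : Matrix ι ι 𝔽, IsReductionMatrix deg D S ∧ pivot ((D * S).col j) = i

/-- The lexicographic order on subsets: `A = B`, or the largest element of the symmetric
difference of `A` and `B` is contained in `B`. -/
def SetLexLE (A B : Finset ι) : Prop :=
  A = B ∨ ∃ m ∈ symmDiff A B, (∀ k ∈ symmDiff A B, k ≤ m) ∧ m ∈ B

/-- The lexicographic preorder on chains. -/
def ChainLexLE (c d : ι → 𝔽) : Prop := SetLexLE (chainSupport c) (chainSupport d)

/-- The strict lexicographic preorder on chains. -/
def ChainLexLT (c d : ι → 𝔽) : Prop := ChainLexLE c d ∧ ¬ ChainLexLE d c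

/-- The space `C_n(L)` of `n`-chains supported on a set `L` of basis elements. -/
def chainsOn (𝔽 : Type*) [Field 𝔽] (deg : ι → ℕ) (L : Set ι) (n : ℕ) : Submodule 𝔽 (ι → 𝔽) where
  carrier := {c | ∀ i, c i ≠ 0 → i ∈ L ∧ deg i = n}
  zero_mem' := fun i h => absurd rfl h
  add_mem' := by
    intro a b ha hb i h
    by_cases h0 : a i = 0
    · exact hb i fun h1 => h (by simp [h0, h1])
    · exact ha i h0
  smul_mem' := by
    intro x a ha i h
    exact ha i fun h1 => h (by simp [h1])

/-- The cycles `Z_n(L)`. -/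
def cyclesOn (deg : ι → ℕ) (D : Matrix ι ι 𝔽) (L : Set ι) (n : ℕ) : Submodule 𝔽 (ι → 𝔽) :=
  chainsOn 𝔽 deg L n ⊓ LinearMap.ker D.mulVecLin

/-- The boundaries `B_n(L)`. -/
def boundariesOn (deg : ι → ℕ) (D : Matrix ι ι 𝔽) (L : Set ι) (n : ℕ) : Submodule 𝔽 (ι → 𝔽) :=
  (chainsOn 𝔽 deg L (n + 1)).map D.mulVecLin

/-- `z` is a lexicographically minimal `n`-chain of `L`: no homologous chain `z + ∂e` with
`e ∈ C_{n+1}(L)` is strictly smaller in the lexicographic preorder. -/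
def IsLexMinimal (deg : ι → ℕ) (D : Matrix ι ι 𝔽) (L : Set ι) (n : ℕ) (z : ι → 𝔽) : Prop :=
  z ∈ chainsOn 𝔽 deg L n ∧ ¬ ∃ e ∈ chainsOn 𝔽 deg L (n + 1), ChainLexLT (z + D *ᵥ e) z

/-- `z` is a lexicographically minimal cycle of the homology class `[c] ∈ H_n(L)` of the cycle
`c` of `L`. -/
def IsLexMinCycleOf (deg : ι → ℕ) (D : Matrix ι ι 𝔽) (L : Set ι) (n : ℕ) (c z : ι → 𝔽) : Prop :=
  c ∈ cyclesOn deg D L n ∧ z ∈ cyclesOn deg D L n ∧ z - c ∈ boundariesOn deg D L n ∧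
    IsLexMinimal deg D L n z

/-- `z` is *the* lexicographically minimal cycle of the homology class `[c] ∈ H_n(L)`. -/
def IsTheLexMinCycleOf (deg : ι → ℕ) (D : Matrix ι ι 𝔽) (L : Set ι) (n : ℕ) (c z : ι → 𝔽) :
    Prop :=
  IsLexMinCycleOf deg D L n c z ∧ ∀ z', IsLexMinCycleOf deg D L n c z' → z' = z

end ElementwiseFiltration

section DiscreteMorse

variable {V : Type*} {K : PreAbstractSimplicialComplex V}

/-- `f` is a generalized discrete Morse function with gradient partition `P`: it is monotonic, `P` is
a partition of `K` into intervals of the face poset, and simplices `σ ⊆ τ` have the same value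
if and only if they lie in a common interval of `P`. -/
structure IsGeneralizedDiscreteMorse (f : K.faces → ℝ) (P : Set (Set K.faces)) : Prop where
  monotone : Monotone f
  partition : Setoid.IsPartition P
  interval : ∀ I ∈ P, ∃ ρ φ : K.faces, ρ ≤ φ ∧ I = Set.Icc ρ φ
  eq_iff : ∀ σ τ : K.faces, σ ≤ τ → (f σ = f τ ↔ ∃ I ∈ P, σ ∈ I ∧ τ ∈ I)

/-- A simplex is critical if it forms a singleton interval of the gradient partition. -/
def IsCritical (P : Set (Set K.faces)) (σ : K.faces) : Prop := {σ} ∈ P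

/-- The canonical order on the gradient partition: the transitive closure of the relation that some
simplex of `I` is a face of some simplex of `J`. -/
def GradientLE (P : Set (Set K.faces)) : Set K.faces → Set K.faces → Prop :=
  Relation.TransGen fun I J => I ∈ P ∧ J ∈ P ∧ ∃ σ ∈ I, ∃ τ ∈ J, σ ≤ τ

/-- The descending complex at scale `r`: the union of the intervals lying below some critical
simplex with value at most `r`. -/
def descendingComplex (f : K.faces → ℝ) (P : Set (Set K.faces)) (r : ℝ) : Set K.faces :=
  ⋃₀ {I | I ∈ P ∧ ∃ σ : K.faces, IsCritical P σ ∧ f σ ≤ r ∧ GradientLE P I {σ}}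

end DiscreteMorse

section FLexicographic

variable {V : Type*} [LinearOrder V] {K : PreAbstractSimplicialComplex V}

/-- The two usual ways to compare simplices of the same dimension lexicographically: by
their vertices listed in increasing order, or by their vertices listed in decreasing order (the
latter is the order `SetLexLE` above, on simplices of the same dimension). -/
inductive VertexListing
  | increasing
  | decreasing

/-- The vertices of a simplex, listed in the chosen way. -/
def VertexListing.list : VertexListing → Finset V → List V
  | .increasing, s => s.sort (· ≤ ·)
  | .decreasing, s => s.sort (· ≥ ·)

theorem VertexListing.list_injective (l : VertexListing) :
    Function.Injective (l.list : Finset V → List V) := by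
  intro s t h
  cases l
  · simpa [VertexListing.list] using congrArg List.toFinset h
  · simpa [VertexListing.list] using congrArg List.toFinset h

/-- The simplices of `K`, carrying the `f`-lexicographic order. -/
@[ext]
structure FSimplex (f : K.faces → ℝ) (l : VertexListing) where
  face : K.faces

variable {f : K.faces → ℝ} {l : VertexListing}

/-- The dimension of a simplex. -/
def FSimplex.dim (σ : FSimplex f l) : ℕ := σ.face.1.card - 1

/-- The sorting key of the `f`-lexicographic order: value, then dimension, then list of vertices. -/
def FSimplex.key (σ : FSimplex f l) : ℝ ×ₗ ℕ ×ₗ List V :=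
  toLex (f σ.face, toLex (σ.dim, l.list σ.face.1))

theorem FSimplex.key_injective : Function.Injective (FSimplex.key : FSimplex f l → _) := by
  intro σ τ h
  have h1 := congrArg (fun x => (ofLex (ofLex x).2).2) h
  exact FSimplex.ext (Subtype.ext (l.list_injective h1))

noncomputable instance : LinearOrder (FSimplex f l) :=
  LinearOrder.lift' FSimplex.key FSimplex.key_injective

instance [Fintype K.faces] : Fintype (FSimplex f l) :=
  Fintype.ofEquiv K.faces ⟨FSimplex.mk, FSimplex.face, fun _ => rfl, fun _ => rfl⟩

/-- The boundary matrix of the simplicial chain complex `C_*(K; 𝔽)`, each simplex being oriented by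
the vertex order, with rows and columns in the `f`-lexicographic order: removing from `τ` its
`k`-th vertex (counted from `0` in increasing order) gives the facet with coefficient `(-1) ^ k`. -/
def boundaryMatrix (𝔽 : Type*) [Field 𝔽] (f : K.faces → ℝ) (l : VertexListing) :
    Matrix (FSimplex f l) (FSimplex f l) 𝔽 := fun ρ τ =>
  ∑ v ∈ τ.face.1,
    if ρ.face.1 = τ.face.1.erase v then (-1) ^ (τ.face.1.filter (· < v)).card else 0

end FLexicographic

end WrapPersistence

open WrapPersistence

/-!
Three facts about the scaled column `z` of `τ` carry the proof.

*Minimality from total reducedness.* Since `S` is invertible and upper triangular, the boundaries of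
chains of simplices preceding `τ` are the linear combinations of the columns of `R` preceding that
of `τ`. In a totally reduced matrix the non-zero columns have distinct pivots, so the pivot of a
non-zero combination is the pivot of one of those columns, where `z` vanishes
(`IsTotallyReduced.exists_pivot_mulVec`). Adding such a boundary to `z` therefore gives a strictly
larger chain (`IsTotallyReduced.chainLexLT_add`), which makes `z` the unique minimal cycle
(`IsReductionMatrix.isTheLexMinCycleOf`), in every set of simplices preceding `τ` that is large
enough to support the cycles `z` and `∂τ` and a homology between them.

*Acyclicity of the regular intervals.* At a fixed value of `f`, simplices of different intervals are
not faces of each other, and a non-singleton interval is closed under inserting and erasing some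
vertex. Hence a union of such intervals at one level carries an acyclic relative chain complex
(`IsGeneralizedDiscreteMorse.exists_boundary_eq_on`). The simplex `τ` of a non-zero pair is
consequently critical, so that `∂τ` lies in the open sublevel set
(`IsReductionMatrix.isCritical_of_col`). If no other critical simplex of its dimension precedes `τ`
at its level, then the chain between `z` and `∂τ` can be moved into the open sublevel set too.

*Pushing down.* If `z` had a simplex outside the descending complex, then the simplices of `z` there
at the highest possible level would lie in regular intervals and form a relative cycle. By
acyclicity they could be replaced by simplices of lower value, contradicting minimality
(`IsLexMinimal.mem_descendingComplex`).
-/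

namespace WrapPersistence

/-! ### Pivots and the lexicographic preorder -/

section Pivot

variable {ι 𝔽 : Type*} [LinearOrder ι] [Fintype ι] [Field 𝔽]

theorem mem_chainSupport {ι 𝔽 : Type*} [Fintype ι] [Field 𝔽] {c : ι → 𝔽} {i : ι} :
    i ∈ chainSupport c ↔ c i ≠ 0 := by
  classical
  simp [chainSupport]

theorem pivot_le_iff {c : ι → 𝔽} {m : WithBot ι} :
    pivot c ≤ m ↔ ∀ i, c i ≠ 0 → (i : WithBot ι) ≤ m := by
  constructor
  · intro h i hi
    exact (Finset.le_max (mem_chainSupport.2 hi)).trans h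
  · intro h
    exact Finset.max_le fun a ha => h a (mem_chainSupport.1 ha)

theorem pivot_eq_coe_iff {c : ι → 𝔽} {p : ι} :
    pivot c = p ↔ c p ≠ 0 ∧ ∀ q, c q ≠ 0 → q ≤ p := by
  constructor
  · intro h
    exact ⟨mem_chainSupport.1 (Finset.mem_of_max h),
      fun q hq => Finset.le_max_of_eq (mem_chainSupport.2 hq) h⟩
  · rintro ⟨h, h'⟩
    refine le_antisymm (pivot_le_iff.2 fun i hi => WithBot.coe_le_coe.2 (h' i hi)) ?_
    exact Finset.le_max (mem_chainSupport.2 h)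

theorem exists_pivot_eq_coe {c : ι → 𝔽} (hc : c ≠ 0) : ∃ p : ι, pivot c = p := by
  obtain ⟨i, hi⟩ := Function.ne_iff.1 hc
  exact Finset.max_of_mem (mem_chainSupport.2 hi)

theorem pivot_eq_bot_iff {c : ι → 𝔽} : pivot c = ⊥ ↔ c = 0 := by
  refine ⟨fun h => ?_, ?_⟩
  · by_contra hc
    obtain ⟨p, hp⟩ := exists_pivot_eq_coe hc
    simp [hp] at h
  · rintro rfl
    exact le_bot_iff.1 (pivot_le_iff.2 fun i hi => absurd rfl hi)

theorem pivot_smul {x : 𝔽} (hx : x ≠ 0) (c : ι → 𝔽) : pivot (x • c) = pivot c := by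
  have : chainSupport (x • c) = chainSupport c := by
    ext i
    simp [mem_chainSupport, hx]
  rw [pivot, this, pivot]

theorem SetLexLE.antisymm {A B : Finset ι} (h : SetLexLE A B) (h' : SetLexLE B A) : A = B := by
  rcases h with h | ⟨m, hm, hmax, hB⟩
  · exact h
  rcases h' with h' | ⟨m', hm', hmax', hA⟩
  · exact h'.symm
  rw [symmDiff_comm] at hm' hmax'
  obtain rfl : m = m' := le_antisymm (hmax' m hm) (hmax m' hm')
  simp [Finset.mem_symmDiff, hA, hB] at hm

theorem ChainLexLT.of_largest {c d : ι → 𝔽} (m : ι) (hc : c m = 0) (hd : d m ≠ 0)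
    (h : ∀ k, m < k → (c k ≠ 0 ↔ d k ≠ 0)) : ChainLexLT c d := by
  have hmc : m ∉ chainSupport c := fun h => mem_chainSupport.1 h hc
  have hmd : m ∈ chainSupport d := mem_chainSupport.2 hd
  have hle : ChainLexLE c d := by
    refine Or.inr ⟨m, Finset.mem_symmDiff.2 (Or.inr ⟨hmd, hmc⟩), fun k hk => ?_, hmd⟩
    by_contra hlt
    have := h k (not_le.1 hlt)
    simp only [Finset.mem_symmDiff, mem_chainSupport] at hk
    tauto
  refine ⟨hle, fun hle' => hmc ?_⟩
  rw [SetLexLE.antisymm hle hle']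
  exact hmd

theorem ChainLexLT.asymm {c d : ι → 𝔽} (h : ChainLexLT c d) : ¬ ChainLexLT d c :=
  fun h' => h.2 h'.1

end Pivot

/-! ### Reductions of a filtration boundary matrix -/

section Reduction

variable {ι 𝔽 : Type*} [LinearOrder ι] [Fintype ι] [Field 𝔽] {deg : ι → ℕ} {D S : Matrix ι ι 𝔽}

theorem exists_ne_zero_of_mulVec_ne_zero {ι 𝔽 : Type*} [Fintype ι] [Field 𝔽] {M : Matrix ι ι 𝔽}
    {a : ι → 𝔽} {i : ι} (h : (M *ᵥ a) i ≠ 0) : ∃ j, M i j ≠ 0 ∧ a j ≠ 0 := by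
  obtain ⟨j, -, hj⟩ := Finset.exists_ne_zero_of_sum_ne_zero h
  exact ⟨j, left_ne_zero_of_mul hj, right_ne_zero_of_mul hj⟩

theorem mul_col {ι 𝔽 : Type*} [Fintype ι] [Field 𝔽] (M N : Matrix ι ι 𝔽) (j : ι) :
    (M * N).col j = M *ᵥ N.col j := by
  ext i
  rfl

theorem IsReductionMatrix.isUnit (hS : IsReductionMatrix deg D S) : IsUnit S := by
  rw [← Matrix.mulVec_surjective_iff_isUnit]
  have h : LinearMap.range S.mulVecLin = ⊤ := by
    apply Submodule.eq_top_of_finrank_eq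
    rw [Module.finrank_fintype_fun_eq_card]
    exact hS.fullRank
  exact LinearMap.range_eq_top.1 h

theorem IsReductionMatrix.blockTriangular (hS : IsReductionMatrix deg D S) :
    S.BlockTriangular id := by
  intro i j hji
  by_contra h
  exact absurd (hS.upperTriangular i j h) (not_le.2 hji)

theorem IsReductionMatrix.diag_ne_zero (hS : IsReductionMatrix deg D S) (i : ι) : S i i ≠ 0 := by
  have h := (Matrix.isUnit_iff_isUnit_det S).1 hS.isUnit
  rw [Matrix.det_of_isUpperTriangular hS.blockTriangular] at h
  exact Finset.prod_ne_zero_iff.1 h.ne_zero i (Finset.mem_univ i)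

/-- The span of the basis elements in a lower set is invariant under the inverse of an invertible
upper triangular matrix. -/
theorem IsReductionMatrix.exists_mulVec_eq (hS : IsReductionMatrix deg D S) {L : Set ι}
    (hL : IsLowerSet L) {e : ι → 𝔽} (he : ∀ i, e i ≠ 0 → i ∈ L) :
    ∃ a : ι → 𝔽, (∀ i, a i ≠ 0 → i ∈ L) ∧ S *ᵥ a = e := by
  obtain ⟨_⟩ := hS.isUnit.nonempty_invertible
  refine ⟨S⁻¹ *ᵥ e, fun i hi => ?_, by rw [Matrix.mulVec_mulVec, Matrix.mul_inv_of_invertible,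
    Matrix.one_mulVec]⟩
  obtain ⟨j, hj, hej⟩ := exists_ne_zero_of_mulVec_ne_zero hi
  refine hL ?_ (he j hej)
  by_contra hij
  exact hj (Matrix.blockTriangular_inv_of_blockTriangular hS.blockTriangular (not_le.1 hij))

/-- The pivot of a reduced column is the smallest pivot of the boundary of any chain with leading
term `τ`, and hence independent of the reduction. -/
theorem IsReductionMatrix.pivot_col_le (hS : IsReductionMatrix deg D S) {τ : ι} {x : ι → 𝔽}
    (hx : ∀ i, x i ≠ 0 → i ≤ τ) (hτ : x τ ≠ 0) :
    pivot ((D * S).col τ) ≤ pivot (D *ᵥ x) := by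
  obtain ⟨a, ha, rfl⟩ := hS.exists_mulVec_eq (isLowerSet_Iic τ) hx
  have haτ : a τ ≠ 0 := by
    obtain ⟨j, hj, haj⟩ := exists_ne_zero_of_mulVec_ne_zero hτ
    rwa [le_antisymm (hS.upperTriangular τ j hj) (ha j haj)]
  have hsplit : a = a τ • (Pi.single τ 1 + (a τ)⁻¹ • Function.update a τ 0) := by
    ext i
    by_cases hi : i = τ
    · subst hi; simp
    · simp [hi, haτ]
  have hD : D *ᵥ (S *ᵥ a) =
      a τ • ((D * S).col τ + (D * S) *ᵥ ((a τ)⁻¹ • Function.update a τ 0)) := by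
    conv_lhs => rw [Matrix.mulVec_mulVec, hsplit]
    rw [Matrix.mulVec_smul, Matrix.mulVec_add, Matrix.mulVec_single_one]
  rw [hD, pivot_smul haτ]
  refine hS.reduced τ _ fun i hi => ?_
  have hiτ : i ≠ τ := by rintro rfl; simp at hi
  have hai : a i ≠ 0 := by
    rintro h
    simp [hiτ, h] at hi
  exact lt_of_le_of_ne (ha i hai) hiτ

theorem IsReductionMatrix.pivot_col_eq {S' : Matrix ι ι 𝔽} (hS : IsReductionMatrix deg D S)
    (hS' : IsReductionMatrix deg D S') (τ : ι) :
    pivot ((D * S).col τ) = pivot ((D * S').col τ) := by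
  refine le_antisymm ?_ ?_
  · rw [mul_col D S']
    exact hS.pivot_col_le (fun i hi => hS'.upperTriangular i τ hi) (hS'.diag_ne_zero τ)
  · rw [mul_col D S]
    exact hS'.pivot_col_le (fun i hi => hS.upperTriangular i τ hi) (hS.diag_ne_zero τ)

/-- The columns of a totally reduced matrix have distinct pivots, so the pivot of a combination of
columns preceding `τ` is the pivot of one of them, and there the column of `τ` vanishes. -/
theorem IsTotallyReduced.exists_pivot_mulVec {R : Matrix ι ι 𝔽} (hR : IsTotallyReduced R) {τ : ι}
    {a : ι → 𝔽} (ha : ∀ i, a i ≠ 0 → i < τ) (h0 : R *ᵥ a ≠ 0) :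
    ∃ p : ι, pivot (R *ᵥ a) = p ∧ R p τ = 0 := by
  classical
  let T : Finset ι := Finset.univ.filter fun i => a i ≠ 0 ∧ R.col i ≠ 0
  have hT : T.Nonempty := by
    obtain ⟨q, hq⟩ := Function.ne_iff.1 h0
    obtain ⟨j, hj, haj⟩ := exists_ne_zero_of_mulVec_ne_zero hq
    exact ⟨j, Finset.mem_filter.2 ⟨Finset.mem_univ j, haj, fun h => hj (congrFun h q)⟩⟩
  obtain ⟨i, hi, himax⟩ := T.exists_max_image (fun i => pivot (R.col i)) hT
  obtain ⟨-, hai, hRi⟩ := Finset.mem_filter.1 hi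
  obtain ⟨p, hp⟩ := exists_pivot_eq_coe hRi
  have hRp := pivot_eq_coe_iff.1 hp
  have hle : ∀ j q, a j ≠ 0 → R q j ≠ 0 → q ≤ p := by
    intro j q haj hq
    have hj := himax j (Finset.mem_filter.2 ⟨Finset.mem_univ j, haj, fun h => hq (congrFun h q)⟩)
    rw [hp] at hj
    exact WithBot.coe_le_coe.1 (pivot_le_iff.1 hj q hq)
  have hzero : ∀ j, j ≠ i → R p j * a j = 0 := by
    intro j hji
    by_contra h
    have haj := right_ne_zero_of_mul h
    have hpj := left_ne_zero_of_mul h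
    rcases lt_or_gt_of_ne hji with hlt | hlt
    · refine hRp.1 (hR j i p hlt ?_)
      exact pivot_eq_coe_iff.2 ⟨hpj, fun q hq => hle j q haj hq⟩
    · exact hpj (hR i j p hlt hp)
  refine ⟨p, pivot_eq_coe_iff.2 ⟨?_, fun q hq => ?_⟩, hR i τ p (ha i hai) hp⟩
  · have : (R *ᵥ a) p = R p i * a i :=
      Finset.sum_eq_single i (fun j _ hj => hzero j hj) (fun h => absurd (Finset.mem_univ i) h)
    rw [this]
    exact mul_ne_zero hRp.1 hai
  · obtain ⟨j, hj, haj⟩ := exists_ne_zero_of_mulVec_ne_zero hq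
    exact hle j q haj hj

/-- A non-zero boundary of a chain of elements preceding `τ` can only increase a multiple of the
totally reduced column of `τ`: its pivot is an index at which that column vanishes. -/
theorem IsTotallyReduced.chainLexLT_add (hS : IsReductionMatrix deg D S)
    (hR : IsTotallyReduced (D * S)) {τ : ι} {e : ι → 𝔽} (he : ∀ i, e i ≠ 0 → i < τ)
    (h0 : D *ᵥ e ≠ 0) (x : 𝔽) :
    ChainLexLT (x • (D * S).col τ) (x • (D * S).col τ + D *ᵥ e) := by
  obtain ⟨a, ha, rfl⟩ := hS.exists_mulVec_eq (isLowerSet_Iio τ) he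
  rw [Matrix.mulVec_mulVec] at h0 ⊢
  obtain ⟨p, hp, hpτ⟩ := hR.exists_pivot_mulVec ha h0
  obtain ⟨hp0, hpmax⟩ := pivot_eq_coe_iff.1 hp
  refine ChainLexLT.of_largest p ?_ ?_ fun k hk => ?_
  · simp [hpτ]
  · simpa [hpτ] using hp0
  · have hk0 : ((D * S) *ᵥ a) k = 0 := by
      by_contra h
      exact absurd (hpmax k h) (not_le.2 hk)
    simp [hk0]

/-- Part of the hypothesis is that `L` is large enough to contain the cycles `∂τ` and `R_τ`, and a
chain witnessing that they are homologous, up to scaling. Any other cycle of the class then differs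
from the scaled column by a non-zero boundary of `L`, hence is larger and not minimal. -/
theorem IsReductionMatrix.isTheLexMinCycleOf (hS : IsReductionMatrix deg D S)
    (hR : IsTotallyReduced (D * S)) (hDD : D * D = 0) {τ : ι} {n : ℕ} {L : Set ι}
    (hL : ∀ i ∈ L, i < τ) (hτL : D.col τ ∈ chainsOn 𝔽 deg L n)
    {e : ι → 𝔽} (he : e ∈ chainsOn 𝔽 deg L (n + 1))
    (hRL : (S τ τ)⁻¹ • (D * S).col τ ∈ chainsOn 𝔽 deg L n)
    (heq : (S τ τ)⁻¹ • (D * S).col τ - D.col τ = D *ᵥ e) :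
    IsTheLexMinCycleOf deg D L n (D.col τ) ((S τ τ)⁻¹ • (D * S).col τ) := by
  have hlt : ∀ e ∈ chainsOn 𝔽 deg L (n + 1), ∀ i, e i ≠ 0 → i < τ :=
    fun e he i hi => hL i (he i hi).1
  have hDτ : D *ᵥ D.col τ = 0 := by
    rw [← mul_col, hDD]
    rfl
  have hDR : D *ᵥ ((S τ τ)⁻¹ • (D * S).col τ) = 0 := by
    rw [Matrix.mulVec_smul, mul_col, Matrix.mulVec_mulVec, hDD, Matrix.zero_mulVec, smul_zero]
  refine ⟨⟨⟨hτL, hDτ⟩, ⟨hRL, hDR⟩, ⟨e, he, heq.symm⟩, hRL, ?_⟩, ?_⟩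
  · rintro ⟨g, hg, hgl⟩
    by_cases h0 : D *ᵥ g = 0
    · rw [h0, add_zero] at hgl
      exact hgl.asymm hgl
    · exact hgl.asymm (hR.chainLexLT_add hS (hlt g hg) h0 _)
  · rintro z' ⟨-, -, ⟨e', he', heq'⟩, -, hmin⟩
    by_contra hne
    have he'' : D *ᵥ e' = z' - D.col τ := heq'
    -- The difference of the two homologous cycles is the boundary of `e' - e`.
    have hz' : z' = (S τ τ)⁻¹ • (D * S).col τ + D *ᵥ (e' - e) := by
      rw [Matrix.mulVec_sub, ← heq, he'']
      abel
    have hg := Submodule.sub_mem _ he' he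
    have h0 : D *ᵥ (e' - e) ≠ 0 := by
      intro h0
      rw [h0, add_zero] at hz'
      exact hne hz'
    refine hmin ⟨-(e' - e), Submodule.neg_mem _ hg, ?_⟩
    have := hR.chainLexLT_add hS (hlt _ hg) h0 (S τ τ)⁻¹
    rw [← hz'] at this
    convert this using 1
    rw [Matrix.mulVec_neg, hz']
    abel

end Reduction

/-! ### The simplicial boundary matrix -/

section Boundary

variable {V : Type*} [LinearOrder V] {K : PreAbstractSimplicialComplex V} {f : K.faces → ℝ}
  {l : VertexListing} {𝔽 : Type*} [Field 𝔽]

theorem face_nonempty {V : Type*} {K : PreAbstractSimplicialComplex V} (α : K.faces) :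
    α.1.Nonempty :=
  (K.isRelLowerSet_faces α.2).1

theorem exists_face_of_subset {V : Type*} {K : PreAbstractSimplicialComplex V} {s : Finset V}
    (hs : s.Nonempty) {φ : K.faces} (h : s ⊆ φ.1) : ∃ α : K.faces, α.1 = s :=
  ⟨⟨s, (K.isRelLowerSet_faces φ.2).2 h hs⟩, rfl⟩

theorem FSimplex.dim_add_one {V : Type*} {K : PreAbstractSimplicialComplex V} {f : K.faces → ℝ}
    {l : VertexListing} (σ : FSimplex f l) : σ.dim + 1 = σ.face.1.card :=
  Nat.sub_add_cancel (face_nonempty σ.face).card_pos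

theorem FSimplex.lt_iff_key_lt {σ τ : FSimplex f l} : σ < τ ↔ σ.key < τ.key := Iff.rfl

theorem FSimplex.lt_of_value_lt {σ τ : FSimplex f l} (h : f σ.face < f τ.face) : σ < τ :=
  lt_iff_key_lt.2 (Prod.Lex.lt_iff.2 (Or.inl h))

theorem FSimplex.lt_of_dim_lt {σ τ : FSimplex f l} (h : f σ.face ≤ f τ.face)
    (h' : σ.dim < τ.dim) : σ < τ := by
  rcases h.lt_or_eq with h | h
  · exact lt_of_value_lt h
  · exact lt_iff_key_lt.2 (Prod.Lex.lt_iff.2 (Or.inr ⟨h, Prod.Lex.lt_iff.2 (Or.inl h')⟩))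

theorem FSimplex.value_le {σ τ : FSimplex f l} (h : σ ≤ τ) : f σ.face ≤ f τ.face := by
  by_contra hlt
  exact absurd h (not_le.2 (lt_of_value_lt (not_le.1 hlt)))

theorem exists_of_boundaryMatrix_ne_zero {ρ τ : FSimplex f l} (h : boundaryMatrix 𝔽 f l ρ τ ≠ 0) :
    ∃ v ∈ τ.face.1, ρ.face.1 = τ.face.1.erase v := by
  obtain ⟨v, hv, h'⟩ := Finset.exists_ne_zero_of_sum_ne_zero h
  exact ⟨v, hv, by_contra fun h0 => h' (if_neg h0)⟩

theorem le_of_boundaryMatrix_ne_zero {ρ τ : FSimplex f l} (h : boundaryMatrix 𝔽 f l ρ τ ≠ 0) :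
    ρ.face ≤ τ.face := by
  obtain ⟨v, -, hv⟩ := exists_of_boundaryMatrix_ne_zero h
  change ρ.face.1 ⊆ τ.face.1
  exact hv ▸ Finset.erase_subset _ _

theorem dim_of_boundaryMatrix_ne_zero {ρ τ : FSimplex f l} (h : boundaryMatrix 𝔽 f l ρ τ ≠ 0) :
    ρ.dim + 1 = τ.dim := by
  obtain ⟨v, hv, h'⟩ := exists_of_boundaryMatrix_ne_zero h
  rw [ρ.dim_add_one, h', Finset.card_erase_of_mem hv]
  rfl

theorem lt_of_boundaryMatrix_ne_zero (hf : Monotone f) {ρ τ : FSimplex f l}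
    (h : boundaryMatrix 𝔽 f l ρ τ ≠ 0) : ρ < τ := by
  refine FSimplex.lt_of_dim_lt (hf (le_of_boundaryMatrix_ne_zero h)) ?_
  have := dim_of_boundaryMatrix_ne_zero h
  omega

theorem boundaryMatrix_col_mem_chainsOn {τ : FSimplex f l} {n : ℕ} (hn : n + 1 = τ.dim)
    {L : Set (FSimplex f l)} (hL : ∀ η, boundaryMatrix 𝔽 f l η τ ≠ 0 → η ∈ L) :
    (boundaryMatrix 𝔽 f l).col τ ∈ chainsOn 𝔽 FSimplex.dim L n := by
  refine fun η hη => ⟨hL η hη, ?_⟩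
  have := dim_of_boundaryMatrix_ne_zero hη
  omega

theorem boundaryMatrix_of_eq_erase {ρ τ : FSimplex f l} {v : V} (hv : v ∈ τ.face.1)
    (h : ρ.face.1 = τ.face.1.erase v) :
    boundaryMatrix 𝔽 f l ρ τ = (-1) ^ (τ.face.1.filter (· < v)).card := by
  unfold boundaryMatrix
  rw [Finset.sum_eq_single v, if_pos h]
  · intro u hu huv
    refine if_neg fun h' => huv ?_
    exact (Finset.erase_injOn τ.face.1 hv hu (h.symm.trans h')).symm
  · exact fun h' => absurd hv h'

theorem boundaryMatrix_mul_self_of_eq_erase {ρ τ : FSimplex f l} {v : V} (hv : v ∈ τ.face.1)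
    (h : ρ.face.1 = τ.face.1.erase v) :
    boundaryMatrix 𝔽 f l ρ τ * boundaryMatrix 𝔽 f l ρ τ = 1 := by
  rw [boundaryMatrix_of_eq_erase hv h, ← mul_pow]
  simp

theorem sign_erase_comm {s : Finset V} {u v : V} (hu : u ∈ s) (huv : u < v) :
    (-1 : 𝔽) ^ ((s.erase v).filter (· < u)).card * (-1) ^ (s.filter (· < v)).card +
      (-1) ^ ((s.erase u).filter (· < v)).card * (-1) ^ (s.filter (· < u)).card = 0 := by
  have h1 : (s.erase v).filter (· < u) = s.filter (· < u) := by
    rw [Finset.filter_erase, Finset.erase_eq_of_notMem]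
    simp [huv.le]
  have h2 : ((s.erase u).filter (· < v)).card + 1 = (s.filter (· < v)).card := by
    rw [Finset.filter_erase, Finset.card_erase_add_one]
    simp [hu, huv]
  rw [h1, ← h2, pow_succ]
  ring

variable [Fintype K.faces]

theorem boundaryMatrix_mul_apply (ρ τ : FSimplex f l) :
    (boundaryMatrix 𝔽 f l * boundaryMatrix 𝔽 f l) ρ τ =
      ∑ v ∈ τ.face.1, ∑ u ∈ τ.face.1.erase v,
        if ρ.face.1 = (τ.face.1.erase v).erase u then
          (-1) ^ ((τ.face.1.erase v).filter (· < u)).card *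
            (-1) ^ (τ.face.1.filter (· < v)).card
        else 0 := by
  have h1 : (boundaryMatrix 𝔽 f l * boundaryMatrix 𝔽 f l) ρ τ =
      ∑ v ∈ τ.face.1, ∑ μ : FSimplex f l, boundaryMatrix 𝔽 f l ρ μ *
        if μ.face.1 = τ.face.1.erase v then (-1) ^ (τ.face.1.filter (· < v)).card else 0 := by
    rw [Finset.sum_comm]
    refine Finset.sum_congr rfl fun μ _ => ?_
    rw [← Finset.mul_sum]
    rfl
  rw [h1]
  refine Finset.sum_congr rfl fun v hv => ?_
  rcases (τ.face.1.erase v).eq_empty_or_nonempty with h0 | h0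
  -- Faces are non-empty, so a vertex has no facet; both sides are empty sums.
  · rw [h0, Finset.sum_empty]
    refine Finset.sum_eq_zero fun μ _ => ?_
    rw [if_neg (face_nonempty μ.face).ne_empty, mul_zero]
  · obtain ⟨α, hα⟩ := exists_face_of_subset h0 (Finset.erase_subset v τ.face.1)
    rw [Finset.sum_eq_single (⟨α⟩ : FSimplex f l)]
    · rw [if_pos hα, ← hα]
      simp only [boundaryMatrix]
      rw [Finset.sum_mul]
      simp only [ite_mul, zero_mul]
    · intro μ _ hμ
      rw [if_neg, mul_zero]
      exact fun h => hμ (FSimplex.ext (Subtype.ext (h.trans hα.symm)))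
    · exact fun h => absurd (Finset.mem_univ _) h

theorem boundaryMatrix_mul_boundaryMatrix :
    boundaryMatrix 𝔽 f l * boundaryMatrix 𝔽 f l = 0 := by
  ext ρ τ
  rw [boundaryMatrix_mul_apply, Finset.sum_sigma', Matrix.zero_apply]
  refine Finset.sum_involution (fun x _ => ⟨x.2, x.1⟩) ?_ ?_ ?_ ?_
  · rintro ⟨v, u⟩ h
    simp only [Finset.mem_sigma, Finset.mem_erase] at h
    rw [Finset.erase_right_comm (a := u)]
    split_ifs
    · rcases lt_or_gt_of_ne h.2.1 with huv | huv
      · exact sign_erase_comm h.2.2 huv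
      · rw [add_comm]
        exact sign_erase_comm h.1 huv
    · exact add_zero 0
  · rintro ⟨v, u⟩ h - heq
    simp only [Finset.mem_sigma, Finset.mem_erase] at h
    exact h.2.1 (congrArg Sigma.fst heq)
  · rintro ⟨v, u⟩ h
    simp only [Finset.mem_sigma, Finset.mem_erase] at h ⊢
    exact ⟨h.2.2, h.2.1.symm, h.1⟩
  · rintro ⟨v, u⟩ h
    rfl

end Boundary

/-! ### Acyclicity of the regular intervals -/

section Gradient

theorem IsGeneralizedDiscreteMorse.eq_of_mem {V : Type*} {K : PreAbstractSimplicialComplex V}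
    {f : K.faces → ℝ} {P : Set (Set K.faces)} (hf : IsGeneralizedDiscreteMorse f P)
    {I J : Set K.faces} (hI : I ∈ P) (hJ : J ∈ P) {α : K.faces} (hαI : α ∈ I) (hαJ : α ∈ J) :
    I = J :=
  (hf.partition.2 α).unique ⟨hI, hαI⟩ ⟨hJ, hαJ⟩

theorem IsGeneralizedDiscreteMorse.value_eq {V : Type*} {K : PreAbstractSimplicialComplex V}
    {f : K.faces → ℝ} {P : Set (Set K.faces)} (hf : IsGeneralizedDiscreteMorse f P)
    {I : Set K.faces} (hI : I ∈ P) {α β : K.faces} (hα : α ∈ I) (hβ : β ∈ I) : f α = f β := by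
  obtain ⟨ρ, φ, hρφ, rfl⟩ := hf.interval I hI
  have h : ∀ γ ∈ Set.Icc ρ φ, f ρ = f γ := fun γ hγ =>
    (hf.eq_iff ρ γ hγ.1).2 ⟨_, hI, ⟨le_rfl, hρφ⟩, hγ⟩
  rw [← h α hα, h β hβ]

theorem IsGeneralizedDiscreteMorse.isCritical_iff {V : Type*} {K : PreAbstractSimplicialComplex V}
    {f : K.faces → ℝ} {P : Set (Set K.faces)} (hf : IsGeneralizedDiscreteMorse f P)
    {I : Set K.faces} (hI : I ∈ P) {α : K.faces} (hα : α ∈ I) : IsCritical P α ↔ I = {α} :=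
  ⟨fun h => hf.eq_of_mem hI h hα rfl, fun h => by rwa [IsCritical, ← h]⟩

theorem IsGeneralizedDiscreteMorse.not_isCritical_of_le {V : Type*}
    {K : PreAbstractSimplicialComplex V} {f : K.faces → ℝ} {P : Set (Set K.faces)}
    (hf : IsGeneralizedDiscreteMorse f P) {α β : K.faces} (hβα : β ≤ α) (h : f β = f α)
    (hβ : ¬ IsCritical P β) : ¬ IsCritical P α := by
  obtain ⟨I, hI, hβI, hαI⟩ := (hf.eq_iff β α hβα).1 h
  intro hα
  rw [(hf.isCritical_iff hI hαI).1 hα] at hβI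
  obtain rfl : β = α := hβI
  exact hβ hα

variable {V : Type*} [LinearOrder V] {K : PreAbstractSimplicialComplex V} {f : K.faces → ℝ}
  {P : Set (Set K.faces)} {l : VertexListing} {𝔽 : Type*} [Field 𝔽]

/-- Every non-singleton interval `[ρ, φ]` is closed under inserting and erasing any vertex
`v ∈ φ \ ρ`. The function `v` chooses one such vertex for each interval. -/
theorem IsGeneralizedDiscreteMorse.exists_toggle (hf : IsGeneralizedDiscreteMorse f P) :
    ∃ v : K.faces → V, ∀ I ∈ P, ∀ α ∈ I, ¬ IsCritical P α →
      (∀ β ∈ I, v β = v α) ∧ (∃ β ∈ I, β.1 = insert (v α) α.1) ∧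
        ∃ β ∈ I, β.1 = α.1.erase (v α) := by
  have key : ∀ I : Set K.faces, I ∈ P → ∃ u : V, ∀ α ∈ I, ¬ IsCritical P α →
      (∃ β ∈ I, β.1 = insert u α.1) ∧ ∃ β ∈ I, β.1 = α.1.erase u := by
    intro I hI
    by_cases h : ∃ α ∈ I, ¬ IsCritical P α
    · obtain ⟨α₀, hα₀, hcrit⟩ := h
      obtain ⟨ρ, φ, hρφ, rfl⟩ := hf.interval I hI
      have hne : ρ ≠ φ := by
        rintro rfl
        rw [Set.Icc_self] at hα₀ hI
        obtain rfl : α₀ = ρ := hα₀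
        exact hcrit hI
      obtain ⟨u, huφ, huρ⟩ := Finset.exists_of_ssubset
        (show ρ.1 ⊂ φ.1 from lt_of_le_of_ne (α := K.faces) hρφ hne)
      refine ⟨u, fun α hα _ => ?_⟩
      have h1 : ρ.1 ⊆ α.1 := hα.1
      have h2 : α.1 ⊆ φ.1 := hα.2
      have hins : insert u α.1 ⊆ φ.1 := Finset.insert_subset huφ h2
      have hers : ρ.1 ⊆ α.1.erase u := Finset.subset_erase.2 ⟨h1, huρ⟩
      have hers' : α.1.erase u ⊆ φ.1 := (Finset.erase_subset _ _).trans h2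
      obtain ⟨β, hβ⟩ := exists_face_of_subset (Finset.insert_nonempty u α.1) hins
      obtain ⟨γ, hγ⟩ := exists_face_of_subset ((face_nonempty ρ).mono hers) hers'
      refine ⟨⟨β, ⟨?_, ?_⟩, hβ⟩, γ, ⟨?_, ?_⟩, hγ⟩
      · change ρ.1 ⊆ β.1
        exact hβ ▸ h1.trans (Finset.subset_insert _ _)
      · change β.1 ⊆ φ.1
        exact hβ ▸ hins
      · change ρ.1 ⊆ γ.1
        exact hγ ▸ hers
      · change γ.1 ⊆ φ.1
        exact hγ ▸ hers'
    · obtain ⟨α, -⟩ := Setoid.nonempty_of_mem_partition hf.partition hI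
      exact ⟨(face_nonempty α).choose, fun α hα hc => absurd ⟨α, hα, hc⟩ h⟩
  choose u hu using key
  choose block hblock using fun α => (hf.partition.2 α).exists
  refine ⟨fun α => u (block α) (hblock α).1, fun I hI α hα hc => ?_⟩
  have hb : ∀ β ∈ I, block β = I := fun β hβ =>
    hf.eq_of_mem (hblock β).1 hI (hblock β).2 hβ
  simp only [hb α hα]
  exact ⟨fun β hβ => by simp only [hb β hβ], hu I hI α hα hc⟩

variable [Fintype K.faces]

/-- The union `B` of some non-singleton intervals at level `t` carries an acyclic relative chain
complex: if no simplex of `c` outside `B` has a face in `B`, and `∂c` vanishes on `B`, then `c`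
agrees on `B` with the boundary of a chain `w` of `B`. The chain `w` is the cone over `c` with apex
the chosen vertex of each interval. -/
theorem IsGeneralizedDiscreteMorse.exists_boundary_eq_on (hf : IsGeneralizedDiscreteMorse f P)
    {t : ℝ} {B : Set K.faces} (hBt : ∀ β ∈ B, f β = t) (hBc : ∀ β ∈ B, ¬ IsCritical P β)
    (hBP : ∀ I ∈ P, ∀ α ∈ I, ∀ β ∈ I, α ∈ B → β ∈ B) {c : FSimplex f l → 𝔽} {d : ℕ}
    (hd : ∀ α, c α ≠ 0 → α.dim = d)
    (hc : ∀ α, c α ≠ 0 → ∀ β ∈ B, β ≤ α.face → α.face ∈ B)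
    (hDc : ∀ β : FSimplex f l, β.face ∈ B → (boundaryMatrix 𝔽 f l *ᵥ c) β = 0) :
    ∃ w ∈ chainsOn 𝔽 FSimplex.dim {α : FSimplex f l | α.face ∈ B} (d + 1),
      (∀ β : FSimplex f l, β.face ∈ B → (boundaryMatrix 𝔽 f l *ᵥ w) β = c β) ∧
      ∀ β : FSimplex f l, β.face ∉ B → t ≤ f β.face → (boundaryMatrix 𝔽 f l *ᵥ w) β = 0 := by
  classical
  obtain ⟨v, hv⟩ := hf.exists_toggle
  -- A simplex of level at least `t` with a coface in `B` lies in the interval of that coface.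
  have hsame : ∀ α β : K.faces, β ≤ α → α ∈ B → t ≤ f β → β ∈ B := by
    intro α β hβα hα ht
    have h : f β = f α := le_antisymm (hf.monotone hβα) (hBt α hα ▸ ht)
    obtain ⟨I, hI, hβI, hαI⟩ := (hf.eq_iff β α hβα).1 h
    exact hBP I hI α hαI β hβI hα
  let w : FSimplex f l → 𝔽 := fun α =>
    if α.face ∈ B ∧ v α.face ∈ α.face.1 then
      ∑ β : FSimplex f l, if β.face.1 = α.face.1.erase (v α.face) then
        boundaryMatrix 𝔽 f l β α * c β else 0
    else 0
  have hw0 : ∀ α, w α ≠ 0 → α.face ∈ B ∧ v α.face ∈ α.face.1 := fun α h =>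
    by_contra fun h' => h (if_neg h')
  have hDw : ∀ β, (boundaryMatrix 𝔽 f l *ᵥ w) β ≠ 0 →
      ∃ α : FSimplex f l, α.face ∈ B ∧ β.face ≤ α.face := by
    intro β h
    obtain ⟨α, hβα, hα⟩ := exists_ne_zero_of_mulVec_ne_zero h
    exact ⟨α, (hw0 α hα).1, le_of_boundaryMatrix_ne_zero hβα⟩
  have hoff : ∀ β : FSimplex f l, β.face ∉ B → t ≤ f β.face →
      (boundaryMatrix 𝔽 f l *ᵥ w) β = 0 := by
    intro β hβ ht
    by_contra h
    obtain ⟨α, hα, hβα⟩ := hDw β h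
    exact hβ (hsame _ _ hβα hα ht)
  -- On the simplices avoiding the apex, the boundary of the cone over `c` is `c` by construction.
  have hbase : ∀ β : FSimplex f l, β.face ∈ B → v β.face ∉ β.face.1 →
      (boundaryMatrix 𝔽 f l *ᵥ w) β = c β := by
    intro β hβ hvβ
    obtain ⟨I, hI, hβI⟩ := (hf.partition.2 β.face).exists
    obtain ⟨hvI, ⟨α, hαI, hα⟩, -⟩ := hv I hI β.face hβI (hBc _ hβ)
    have hvα : v α = v β.face := hvI α hαI
    have hαB : α ∈ B := hBP I hI _ hβI _ hαI hβ
    have hmem : v α ∈ α.1 := by rw [hα, hvα]; exact Finset.mem_insert_self _ _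
    have hβα : β.face.1 = α.1.erase (v α) := by rw [hα, hvα, Finset.erase_insert hvβ]
    have hwα : w ⟨α⟩ = boundaryMatrix 𝔽 f l β ⟨α⟩ * c β := by
      simp only [w]
      rw [if_pos ⟨hαB, hmem⟩, Finset.sum_eq_single β, if_pos hβα]
      · exact fun γ _ hγ => if_neg fun h =>
          hγ (FSimplex.ext (Subtype.ext (h.trans hβα.symm)))
      · exact fun h => absurd (Finset.mem_univ _) h
    have hsum : (boundaryMatrix 𝔽 f l *ᵥ w) β = boundaryMatrix 𝔽 f l β ⟨α⟩ * w ⟨α⟩ := by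
      refine Finset.sum_eq_single _ (fun γ _ hγ => ?_) (fun h => absurd (Finset.mem_univ _) h)
      by_contra h
      have hDγ := left_ne_zero_of_mul h
      obtain ⟨hγB, hvγ⟩ := hw0 γ (right_ne_zero_of_mul h)
      have hle := le_of_boundaryMatrix_ne_zero hDγ
      obtain ⟨J, hJ, hβJ, hγJ⟩ := (hf.eq_iff _ _ hle).1 ((hBt _ hβ).trans (hBt _ hγB).symm)
      obtain rfl := hf.eq_of_mem hI hJ hβI hβJ
      rw [hvI _ hγJ] at hvγ
      obtain ⟨x, hx, hβx⟩ := exists_of_boundaryMatrix_ne_zero hDγ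
      have hxv : x = v β.face := by
        by_contra hne
        exact hvβ (hβx ▸ Finset.mem_erase.2 ⟨Ne.symm hne, hvγ⟩)
      refine hγ (FSimplex.ext (Subtype.ext ?_))
      change γ.face.1 = α.1
      rw [hα, hβx, ← hβx, ← hxv, hβx, Finset.insert_erase hx]
    rw [hsum, hwα, ← mul_assoc, boundaryMatrix_mul_self_of_eq_erase hmem hβα, one_mul]
  refine ⟨w, ?_, ?_, hoff⟩
  · intro α hα
    obtain ⟨hαB, hvα⟩ := hw0 α hα
    refine ⟨hαB, ?_⟩
    simp only [w] at hα
    rw [if_pos ⟨hαB, hvα⟩] at hα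
    obtain ⟨β, -, hβ⟩ := Finset.exists_ne_zero_of_sum_ne_zero hα
    have hβ' := (ite_ne_right_iff.1 hβ).2
    rw [← dim_of_boundaryMatrix_ne_zero (left_ne_zero_of_mul hβ'), hd β (right_ne_zero_of_mul hβ')]
  -- The difference `c - ∂w` has the same boundary as `c`. At a simplex containing the apex, its
  -- coefficient is read off from the boundary coefficient at the opposite facet.
  · intro β hβ
    by_cases hvβ : v β.face ∈ β.face.1
    swap
    · exact hbase β hβ hvβ
    obtain ⟨I, hI, hβI⟩ := (hf.partition.2 β.face).exists
    obtain ⟨hvI, -, γ, hγI, hγ⟩ := hv I hI β.face hβI (hBc _ hβ)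
    have hγB : γ ∈ B := hBP I hI _ hβI _ hγI hβ
    have hDc' : (boundaryMatrix 𝔽 f l *ᵥ (c - boundaryMatrix 𝔽 f l *ᵥ w)) ⟨γ⟩ = 0 := by
      rw [Matrix.mulVec_sub, Matrix.mulVec_mulVec, boundaryMatrix_mul_boundaryMatrix,
        Matrix.zero_mulVec, sub_zero]
      exact hDc ⟨γ⟩ hγB
    have hsum : (boundaryMatrix 𝔽 f l *ᵥ (c - boundaryMatrix 𝔽 f l *ᵥ w)) ⟨γ⟩ =
        boundaryMatrix 𝔽 f l ⟨γ⟩ β * (c - boundaryMatrix 𝔽 f l *ᵥ w) β := by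
      refine Finset.sum_eq_single _ (fun α _ hα => ?_) (fun h => absurd (Finset.mem_univ _) h)
      by_contra h
      have hDα := left_ne_zero_of_mul h
      have hcα := right_ne_zero_of_mul h
      have hle : γ ≤ α.face := le_of_boundaryMatrix_ne_zero hDα
      have hαB : α.face ∈ B := by
        by_cases h0 : c α = 0
        · have hDwα : (boundaryMatrix 𝔽 f l *ᵥ w) α ≠ 0 := by
            intro h1
            simp [h0, h1] at hcα
          obtain ⟨δ, hδ, hαδ⟩ := hDw α hDwα
          exact hsame _ _ hαδ hδ (hBt γ hγB ▸ hf.monotone hle)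
        · exact hc α h0 γ hγB hle
      obtain ⟨J, hJ, hγJ, hαJ⟩ := (hf.eq_iff _ _ hle).1 ((hBt _ hγB).trans (hBt _ hαB).symm)
      obtain rfl := hf.eq_of_mem hI hJ hγI hγJ
      have hvα : v α.face = v β.face := hvI _ hαJ
      have hmem : v β.face ∈ α.face.1 := by
        by_contra hn
        rw [← hvα] at hn
        exact hcα (by rw [Pi.sub_apply, hbase α hαB hn, sub_self])
      obtain ⟨x, hx, hγx⟩ := exists_of_boundaryMatrix_ne_zero hDα
      change γ.1 = α.face.1.erase x at hγx
      have hxv : x = v β.face := by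
        by_contra hne
        have : v β.face ∈ γ.1 := hγx ▸ Finset.mem_erase.2 ⟨Ne.symm hne, hmem⟩
        rw [hγ] at this
        exact Finset.notMem_erase _ _ this
      refine hα (FSimplex.ext (Subtype.ext ?_))
      rw [← Finset.insert_erase hx, ← hγx, hγ, hxv, Finset.insert_erase hvβ]
    rw [hsum] at hDc'
    have hunit := boundaryMatrix_mul_self_of_eq_erase (𝔽 := 𝔽) (ρ := (⟨γ⟩ : FSimplex f l)) hvβ hγ
    have h0 := (mul_eq_zero.1 hDc').resolve_left (left_ne_zero_of_mul (hunit ▸ one_ne_zero))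
    exact (sub_eq_zero.1 h0).symm

end Gradient

/-! ### Columns of non-zero persistence pairs -/

section Column

variable {V : Type*} [LinearOrder V] {K : PreAbstractSimplicialComplex V} [Fintype K.faces]
  {f : K.faces → ℝ} {P : Set (Set K.faces)} {l : VertexListing} {𝔽 : Type*} [Field 𝔽]
  {S : Matrix (FSimplex f l) (FSimplex f l) 𝔽}

theorem IsReductionMatrix.dim_of_mul_ne_zero
    (hS : IsReductionMatrix FSimplex.dim (boundaryMatrix 𝔽 f l) S) {η τ : FSimplex f l}
    (h : (boundaryMatrix 𝔽 f l * S) η τ ≠ 0) : η.dim + 1 = τ.dim := by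
  rw [← Matrix.col_apply (boundaryMatrix 𝔽 f l * S), mul_col] at h
  obtain ⟨k, hk, hkτ⟩ := exists_ne_zero_of_mulVec_ne_zero h
  rw [dim_of_boundaryMatrix_ne_zero hk]
  exact hS.homogeneous k τ hkτ

theorem IsReductionMatrix.lt_of_mul_ne_zero (hf : Monotone f)
    (hS : IsReductionMatrix FSimplex.dim (boundaryMatrix 𝔽 f l) S) {η τ : FSimplex f l}
    (h : (boundaryMatrix 𝔽 f l * S) η τ ≠ 0) : η < τ := by
  rw [← Matrix.col_apply (boundaryMatrix 𝔽 f l * S), mul_col] at h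
  obtain ⟨k, hk, hkτ⟩ := exists_ne_zero_of_mulVec_ne_zero h
  exact (lt_of_boundaryMatrix_ne_zero hf hk).trans_le (hS.upperTriangular k τ hkτ)

/-- `exists_boundary_eq_on` for the union of all non-singleton intervals at one level. -/
theorem IsGeneralizedDiscreteMorse.exists_boundary_eq_on_level
    (hf : IsGeneralizedDiscreteMorse f P) {t : ℝ} {c : FSimplex f l → 𝔽} {d : ℕ}
    (hd : ∀ α, c α ≠ 0 → α.dim = d) (hc : ∀ α, c α ≠ 0 → f α.face ≤ t)
    (hDc : ∀ β : FSimplex f l, f β.face = t → ¬ IsCritical P β.face →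
      (boundaryMatrix 𝔽 f l *ᵥ c) β = 0) :
    ∃ w ∈ chainsOn 𝔽 FSimplex.dim {α : FSimplex f l | f α.face = t} (d + 1),
      (∀ β : FSimplex f l, f β.face = t → ¬ IsCritical P β.face →
        (boundaryMatrix 𝔽 f l *ᵥ w) β = c β) ∧
      ∀ β : FSimplex f l, t ≤ f β.face → (f β.face = t → IsCritical P β.face) →
        (boundaryMatrix 𝔽 f l *ᵥ w) β = 0 := by
  have hBP : ∀ I ∈ P, ∀ α ∈ I, ∀ β ∈ I, f α = t ∧ ¬ IsCritical P α →
      f β = t ∧ ¬ IsCritical P β := by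
    rintro I hI α hα β hβ ⟨hαt, hαc⟩
    refine ⟨hf.value_eq hI hβ hα ▸ hαt, fun hβc => hαc ?_⟩
    rw [(hf.isCritical_iff hI hβ).1 hβc] at hα
    exact (show α = β from hα) ▸ hβc
  have hc' : ∀ α, c α ≠ 0 → ∀ β, f β = t ∧ ¬ IsCritical P β → β ≤ α.face →
      f α.face = t ∧ ¬ IsCritical P α.face := by
    rintro α hα β ⟨hβt, hβc⟩ hβα
    have h : f β = f α.face := le_antisymm (hf.monotone hβα) (hβt.symm ▸ hc α hα)
    exact ⟨h ▸ hβt, hf.not_isCritical_of_le hβα h hβc⟩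
  obtain ⟨w, hw, hw1, hw2⟩ := hf.exists_boundary_eq_on (t := t)
    (B := {β | f β = t ∧ ¬ IsCritical P β}) (fun β hβ => hβ.1) (fun β hβ => hβ.2) hBP hd hc'
    (fun β hβ => hDc β hβ.1 hβ.2)
  exact ⟨w, fun α hα => ⟨(hw α hα).1.1, (hw α hα).2⟩, fun β h h' => hw1 β ⟨h, h'⟩,
    fun β h h' => hw2 β (fun hB => hB.2 (h' hB.1)) h⟩

/-- If the column of `τ` is non-zero with all entries at levels below that of `τ`, then `τ` is
critical: otherwise the column of `S` with boundary `R_τ` is a relative cycle on the level of `τ`,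
so there is a boundary `∂w` with leading term `τ`, and as `∂∂w = 0` the reduced column of `τ` is
zero. -/
theorem IsReductionMatrix.isCritical_of_col (hf : IsGeneralizedDiscreteMorse f P)
    (hS : IsReductionMatrix FSimplex.dim (boundaryMatrix 𝔽 f l) S) {τ : FSimplex f l}
    (h0 : (boundaryMatrix 𝔽 f l * S).col τ ≠ 0)
    (hlt : ∀ η : FSimplex f l, (boundaryMatrix 𝔽 f l * S) η τ ≠ 0 → f η.face < f τ.face) :
    IsCritical P τ.face := by
  by_contra hτ
  obtain ⟨w, -, hw1, hw2⟩ := hf.exists_boundary_eq_on_level (t := f τ.face) (c := S.col τ)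
    (fun α hα => hS.homogeneous α τ hα)
    (fun α hα => FSimplex.value_le (hS.upperTriangular α τ hα)) (fun β hβ _ => by
      rw [← mul_col]
      by_contra h
      exact (hlt β h).ne hβ)
  have hle : ∀ i, (boundaryMatrix 𝔽 f l *ᵥ w) i ≠ 0 → i ≤ τ := by
    intro i hi
    rcases lt_or_ge (f i.face) (f τ.face) with h | h
    · exact (FSimplex.lt_of_value_lt h).le
    · by_cases hic : f i.face = f τ.face → IsCritical P i.face
      · exact absurd (hw2 i h hic) hi
      · obtain ⟨h1, h2⟩ := Classical.not_imp.1 hic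
        rw [hw1 i h1 h2] at hi
        exact hS.upperTriangular i τ hi
  have hne : (boundaryMatrix 𝔽 f l *ᵥ w) τ ≠ 0 := by
    rw [hw1 τ rfl hτ]
    exact hS.diag_ne_zero τ
  have hpiv := hS.pivot_col_le hle hne
  rw [Matrix.mulVec_mulVec, boundaryMatrix_mul_boundaryMatrix, Matrix.zero_mulVec,
    pivot_eq_bot_iff.2 rfl, le_bot_iff, pivot_eq_bot_iff] at hpiv
  exact h0 hpiv

theorem IsReductionMatrix.scaled_col_mem_chainsOn
    (hS : IsReductionMatrix FSimplex.dim (boundaryMatrix 𝔽 f l) S) {τ : FSimplex f l} {n : ℕ}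
    (hn : n + 1 = τ.dim) {L : Set (FSimplex f l)}
    (hL : ∀ η, (boundaryMatrix 𝔽 f l * S) η τ ≠ 0 → η ∈ L) :
    (S τ τ)⁻¹ • (boundaryMatrix 𝔽 f l * S).col τ ∈ chainsOn 𝔽 FSimplex.dim L n := by
  refine Submodule.smul_mem _ _ fun η hη => ⟨hL η hη, ?_⟩
  have := hS.dim_of_mul_ne_zero hη
  omega

theorem IsReductionMatrix.exists_scaled_col_sub_eq
    (hS : IsReductionMatrix FSimplex.dim (boundaryMatrix 𝔽 f l) S) {τ : FSimplex f l} {n : ℕ}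
    (hn : n + 1 = τ.dim) :
    ∃ e ∈ chainsOn 𝔽 FSimplex.dim {η | η < τ} (n + 1),
      (S τ τ)⁻¹ • (boundaryMatrix 𝔽 f l * S).col τ - (boundaryMatrix 𝔽 f l).col τ =
        boundaryMatrix 𝔽 f l *ᵥ e := by
  refine ⟨(S τ τ)⁻¹ • S.col τ - Pi.single τ 1, fun η hη => ?_, ?_⟩
  · have hητ : η ≠ τ := by
      rintro rfl
      simp [hS.diag_ne_zero] at hη
    have hSη : S η τ ≠ 0 := by
      intro h
      simp [hητ, h] at hη
    exact ⟨lt_of_le_of_ne (hS.upperTriangular η τ hSη) hητ,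
      (hS.homogeneous η τ hSη).trans hn.symm⟩
  · rw [Matrix.mulVec_sub, Matrix.mulVec_smul, Matrix.mulVec_single_one, mul_col]

end Column

/-! ### The descending complex -/

section Descending

variable {V : Type*} {K : PreAbstractSimplicialComplex V} {f : K.faces → ℝ}
  {P : Set (Set K.faces)} {r : ℝ}

theorem mem_descendingComplex_of_isCritical {α : K.faces} (hα : IsCritical P α) (hr : f α ≤ r) :
    α ∈ descendingComplex f P r :=
  ⟨{α}, ⟨hα, α, hα, hr, .single ⟨hα, hα, α, rfl, α, rfl, le_rfl⟩⟩, rfl⟩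

theorem IsGeneralizedDiscreteMorse.mem_descendingComplex_of_mem
    (hf : IsGeneralizedDiscreteMorse f P) {I : Set K.faces} (hI : I ∈ P) {α β : K.faces}
    (hα : α ∈ I) (hβ : β ∈ I) (h : β ∈ descendingComplex f P r) :
    α ∈ descendingComplex f P r := by
  obtain ⟨J, hJ, hβJ⟩ := h
  obtain rfl := hf.eq_of_mem hI hJ.1 hβ hβJ
  exact ⟨I, hJ, hα⟩

theorem IsGeneralizedDiscreteMorse.mem_descendingComplex_of_le
    (hf : IsGeneralizedDiscreteMorse f P) {α β : K.faces} (hβα : β ≤ α)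
    (h : α ∈ descendingComplex f P r) : β ∈ descendingComplex f P r := by
  obtain ⟨J, ⟨hJ, γ, hγ, hγr, hJγ⟩, hαJ⟩ := h
  obtain ⟨I, hI, hβI⟩ := (hf.partition.2 β).exists
  exact ⟨I, ⟨hI, γ, hγ, hγr, .head ⟨hI, hJ, β, hβI, α, hαJ, hβα⟩ hJγ⟩, hβI⟩

end Descending

section LexMinimal

variable {V : Type*} [LinearOrder V] {K : PreAbstractSimplicialComplex V} [Fintype K.faces]
  {f : K.faces → ℝ} {P : Set (Set K.faces)} {l : VertexListing} {𝔽 : Type*} [Field 𝔽] {r : ℝ}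

/-- Outside the descending complex, a lexicographically minimal cycle vanishes: at the highest level
at which it does not, it could be pushed to lower levels, as all intervals there are
non-singletons. -/
theorem IsLexMinimal.mem_descendingComplex (hf : IsGeneralizedDiscreteMorse f P)
    {z : FSimplex f l → 𝔽} {L : Set (FSimplex f l)} {n : ℕ}
    (hz : IsLexMinimal FSimplex.dim (boundaryMatrix 𝔽 f l) L n z)
    (hDz : boundaryMatrix 𝔽 f l *ᵥ z = 0) (hzr : ∀ η, z η ≠ 0 → f η.face ≤ r)
    (hL : ∀ η : FSimplex f l, f η.face ≤ r → η ∈ L) (η : FSimplex f l) (hη : z η ≠ 0) :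
    η.face ∈ descendingComplex f P r := by
  classical
  by_contra hηr
  obtain ⟨m, hm, hmax⟩ := (Finset.univ.filter fun η : FSimplex f l =>
    z η ≠ 0 ∧ η.face ∉ descendingComplex f P r).exists_max_image id
      ⟨η, Finset.mem_filter.2 ⟨Finset.mem_univ η, hη, hηr⟩⟩
  obtain ⟨-, hzm, hmr⟩ := Finset.mem_filter.1 hm
  have hmax' : ∀ α, z α ≠ 0 → α.face ∉ descendingComplex f P r → α ≤ m := fun α h h' =>
    hmax α (Finset.mem_filter.2 ⟨Finset.mem_univ α, h, h'⟩)
  obtain ⟨w, hw, hw1, hw2⟩ := hf.exists_boundary_eq_on (l := l) (t := f m.face) (c := z)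
    (B := {β | f β = f m.face ∧ β ∉ descendingComplex f P r}) (fun β hβ => hβ.1)
    (fun β hβ hc => hβ.2 (mem_descendingComplex_of_isCritical hc (hβ.1 ▸ hzr m hzm)))
    (fun I hI α hα β hβ h => ⟨hf.value_eq hI hβ hα ▸ h.1,
      fun h' => h.2 (hf.mem_descendingComplex_of_mem hI hα hβ h')⟩)
    (fun α hα => (hz.1 α hα).2)
    (fun α hα β hβ hβα => by
      have hαr : α.face ∉ descendingComplex f P r := fun h =>
        hβ.2 (hf.mem_descendingComplex_of_le hβα h)
      refine ⟨le_antisymm (FSimplex.value_le (hmax' α hα hαr)) ?_, hαr⟩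
      exact hβ.1 ▸ hf.monotone hβα)
    (fun β _ => congrFun hDz β)
  have hwL : -w ∈ chainsOn 𝔽 FSimplex.dim L (n + 1) :=
    Submodule.neg_mem _ fun α hα => ⟨hL α ((hw α hα).1.1 ▸ hzr m hzm), (hw α hα).2⟩
  refine hz.2 ⟨-w, hwL, ChainLexLT.of_largest m ?_ hzm fun k hk => ?_⟩
  · simp [Matrix.mulVec_neg, hw1 m ⟨rfl, hmr⟩]
  · have hDw : (boundaryMatrix 𝔽 f l *ᵥ w) k = 0 := by
      by_cases hkB : f k.face = f m.face ∧ k.face ∉ descendingComplex f P r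
      · rw [hw1 k hkB]
        by_contra h
        exact absurd (hmax' k h hkB.2) (not_le.2 hk)
      · exact hw2 k hkB (FSimplex.value_le hk.le)
    simp [Matrix.mulVec_neg, hDw]

end LexMinimal

end WrapPersistence

theorem mainTheorem4 {V : Type*} [LinearOrder V] (K : PreAbstractSimplicialComplex V)
    [Fintype K.faces] (𝔽 : Type*) [Field 𝔽]
    (f : K.faces → ℝ) (P : Set (Set K.faces)) (hf : IsGeneralizedDiscreteMorse f P)
    (l : VertexListing) (S : Matrix (FSimplex f l) (FSimplex f l) 𝔽)
    (hS : IsReductionMatrix FSimplex.dim (boundaryMatrix 𝔽 f l) S)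
    (hR : IsTotallyReduced (boundaryMatrix 𝔽 f l * S))
    (σ τ : FSimplex f l)
    (hστ : IsPersistencePair FSimplex.dim (boundaryMatrix 𝔽 f l) σ τ)
    (hne : f σ.face ≠ f τ.face) :
    -- the suitably scaled column of `τ` is the lexicographically minimal cycle of `[∂τ]` in the
    -- subcomplex of all simplices that precede `τ`
    IsTheLexMinCycleOf FSimplex.dim (boundaryMatrix 𝔽 f l) {η | η < τ} σ.dim
      ((boundaryMatrix 𝔽 f l).col τ) ((S τ τ)⁻¹ • (boundaryMatrix 𝔽 f l * S).col τ) ∧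
    -- likewise in the open sublevel set, unless `τ` is preceded by a critical simplex
    -- of the same value and dimension
    ((∀ η : FSimplex f l, IsCritical P η.face → η < τ → f η.face = f τ.face → η.dim ≠ τ.dim) →
      IsTheLexMinCycleOf FSimplex.dim (boundaryMatrix 𝔽 f l) {η | f η.face < f τ.face} σ.dim
        ((boundaryMatrix 𝔽 f l).col τ) ((S τ τ)⁻¹ • (boundaryMatrix 𝔽 f l * S).col τ)) ∧
    -- the column of `τ` is supported on the descending complex
    (∀ η : FSimplex f l, (boundaryMatrix 𝔽 f l * S) η τ ≠ 0 →
      η.face ∈ descendingComplex f P (f σ.face)) := by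
  obtain ⟨S', hS', hpiv⟩ := hστ
  rw [hS'.pivot_col_eq hS] at hpiv
  obtain ⟨hσ, hmax⟩ := pivot_eq_coe_iff.1 hpiv
  have hdim : σ.dim + 1 = τ.dim := hS.dim_of_mul_ne_zero hσ
  have hvalue : f σ.face < f τ.face :=
    lt_of_le_of_ne (FSimplex.value_le (hS.lt_of_mul_ne_zero hf.monotone hσ).le) hne
  have hRσ : ∀ η : FSimplex f l, (boundaryMatrix 𝔽 f l * S) η τ ≠ 0 → f η.face ≤ f σ.face :=
    fun η hη => FSimplex.value_le (hmax η hη)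
  have hcrit : IsCritical P τ.face :=
    hS.isCritical_of_col hf (fun h => hσ (congrFun h σ)) fun η hη => (hRσ η hη).trans_lt hvalue
  have hfacet : ∀ η : FSimplex f l, boundaryMatrix 𝔽 f l η τ ≠ 0 → f η.face < f τ.face := by
    intro η hη
    have hle := le_of_boundaryMatrix_ne_zero hη
    refine lt_of_le_of_ne (hf.monotone hle) fun heq => ?_
    obtain ⟨I, hI, hηI, hτI⟩ := (hf.eq_iff _ _ hle).1 heq
    rw [(hf.isCritical_iff hI hτI).1 hcrit] at hηI
    have := lt_of_boundaryMatrix_ne_zero hf.monotone hη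
    exact this.ne (FSimplex.ext hηI)
  obtain ⟨e, he, heq⟩ := hS.exists_scaled_col_sub_eq hdim
  have h1 : IsTheLexMinCycleOf FSimplex.dim (boundaryMatrix 𝔽 f l) {η | η < τ} σ.dim
      ((boundaryMatrix 𝔽 f l).col τ) ((S τ τ)⁻¹ • (boundaryMatrix 𝔽 f l * S).col τ) :=
    hS.isTheLexMinCycleOf hR boundaryMatrix_mul_boundaryMatrix (fun _ h => h)
      (boundaryMatrix_col_mem_chainsOn hdim fun η => lt_of_boundaryMatrix_ne_zero hf.monotone) he
      (hS.scaled_col_mem_chainsOn hdim fun η => hS.lt_of_mul_ne_zero hf.monotone) heq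
  refine ⟨h1, fun hτ => ?_, ?_⟩
  -- By assumption `e` has no critical simplex at the level of `τ`, so subtracting `∂w` moves `e`
  -- into the open sublevel set without changing its boundary.
  · obtain ⟨w, hw, hw1, hw2⟩ := hf.exists_boundary_eq_on_level (t := f τ.face)
      (fun α hα => (he α hα).2) (fun α hα => FSimplex.value_le (le_of_lt (he α hα).1))
      (fun β hβ _ => by
        have hRβ : (boundaryMatrix 𝔽 f l * S) β τ = 0 := by
          by_contra h
          exact ((hRσ β h).trans_lt hvalue).ne hβ
        have hDβ : boundaryMatrix 𝔽 f l β τ = 0 := by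
          by_contra h
          exact (hfacet β h).ne hβ
        rw [← heq]
        simp [hRβ, hDβ])
    refine hS.isTheLexMinCycleOf hR boundaryMatrix_mul_boundaryMatrix
      (fun _ h => FSimplex.lt_of_value_lt h) (boundaryMatrix_col_mem_chainsOn hdim hfacet)
      (e := e - boundaryMatrix 𝔽 f l *ᵥ w) (fun α hα => ?_)
      (hS.scaled_col_mem_chainsOn hdim fun η hη => (hRσ η hη).trans_lt hvalue) ?_
    · constructor
      · by_contra hlt
        have hge : f τ.face ≤ f α.face := not_lt.1 hlt
        by_cases hα' : f α.face = f τ.face → IsCritical P α.face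
        · have heα : e α ≠ 0 := by simpa [hw2 α hge hα'] using hα
          obtain ⟨hατ, hαdim⟩ := he α heα
          have hval := le_antisymm (FSimplex.value_le (le_of_lt hατ)) hge
          exact hτ α (hα' hval) hατ hval (hαdim.trans hdim)
        · obtain ⟨h, h'⟩ := Classical.not_imp.1 hα'
          exact hα (by simp [hw1 α h h'])
      · by_cases h0 : e α = 0
        · have hDw : (boundaryMatrix 𝔽 f l *ᵥ w) α ≠ 0 := by simpa [h0] using hα
          obtain ⟨β, hβ, hwβ⟩ := exists_ne_zero_of_mulVec_ne_zero hDw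
          have := dim_of_boundaryMatrix_ne_zero hβ
          have := (hw β hwβ).2
          omega
        · exact (he α h0).2
    · rw [Matrix.mulVec_sub, Matrix.mulVec_mulVec, boundaryMatrix_mul_boundaryMatrix,
        Matrix.zero_mulVec, sub_zero, heq]
  · intro η hη
    refine h1.1.2.2.2.mem_descendingComplex hf h1.1.2.1.2 (fun α hα => hRσ α ?_)
      (fun α hα => FSimplex.lt_of_value_lt (hα.trans_lt hvalue)) η ?_
    · intro h
      simp [h] at hα
    · simpa [hS.diag_ne_zero] using hη
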